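/- Let $N, M\ge 1$ be integers, let $\gamma,\lambda_x,\lambda_v,\lambda_w>0$, and let $w:(\mathbb R^M)^N\times\mathbb R\to\mathbb R^M$ be any function. Let $x_i,v_i:[0,\infty)\to\mathbb R^M$ $(1\le i\le N)$ be differentiable functions, with arbitrary initial data $\{x_i(0),v_i(0)\}_{i=1}^N$, which for all $t\ge 0$ (with right derivatives at $t=0$) solve the herding model $$x_i'=v_i,\qquad v_i'=\frac{\lambda_x}{N}\sum_{j=1}^N\phi_{ij}\,(x_j-x_i)+\frac{\lambda_v}{N}\sum_{j=1}^N\phi_{ij}\,(v_j-v_i)+\lambda_w\,(w(x,t)-x_i),\qquad \phi_{ij}=\frac{1}{(1+|x_i-x_j|^2)^{\gamma/2}}.$$ Put $\hat x_i=x_i-\frac1N\sum_{j=1}^N x_j$, $\hat v_i=v_i-\frac1N\sum_{j=1}^N v_j$, $X(t)=\sum_{i=1}^N|\hat x_i(t)|^2$, $V(t)=\sum_{i=1}^N|\hat v_i(t)|^2$, and $$S_\gamma(t)=\begin{cases}\frac1N\sum_{i,j=1}^N\big\{(1+|\hat x_i-\hat x_j|^2)^{(2-\gamma)/2}-1\big\},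 & 0<\gamma<2,\\[2pt] \frac1N\sum_{i,j=1}^N\log(1+|\hat x_i-\hat x_j|^2), & \gamma=2,\\[2pt] \frac1N\sum_{i,j=1}^N\big\{1-(1+|\hat x_i-\hat x_j|^2)^{-(\gamma-2)/2}\big\}, & \gamma>2,\end{cases}\qquad \beta_\gamma=\begin{cases}2-\gamma, & 0<\gamma<2,\\ 2, & \gamma=2,\\ \gamma-2, & \gamma>2.\end{cases}$$ Then the market energy $$\mathcal E_2(t)=\lambda_w X(t)+V(t)+\lambda_x\beta_\gamma^{-1}S_\gamma(t)$$ tends to $0$ as $t\to\infty$. -/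

import Mathlib

open Filter Topology

noncomputable section

namespace Herding

/-- The communication rate `φ(y, z) = (1 + |y - z|²)^(-γ/2)` between two players whose expected
rates of return (of `M` assets) are `y` and `z`. -/
def commRate {M : ℕ} (γ : ℝ) (y z : EuclideanSpace ℝ (Fin M)) : ℝ :=
  1 / (1 + ‖y - z‖ ^ 2) ^ (γ / 2)

/-- `(x, v)` is a solution on `[0, ∞)` of the herding model with `N` players, `M` assets,
interaction strengths `lamx`, `lamv`, `lamw` and dynamic market signal `w` (a function of the
current configuration and of time). At `t = 0` the derivative is the right derivative. -/
structure IsSolution {N M : ℕ} (γ lamx lamv lamw : ℝ)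
    (w : (Fin N → EuclideanSpace ℝ (Fin M)) → ℝ → EuclideanSpace ℝ (Fin M))
    (x v : ℝ → Fin N → EuclideanSpace ℝ (Fin M)) : Prop where
  deriv_x : ∀ t : ℝ, 0 ≤ t → ∀ i : Fin N,
    HasDerivWithinAt (fun s => x s i) (v t i) (Set.Ici 0) t
  deriv_v : ∀ t : ℝ, 0 ≤ t → ∀ i : Fin N,
    HasDerivWithinAt (fun s => v s i)
      ((lamx / (N : ℝ)) • ∑ j, commRate γ (x t i) (x t j) • (x t j - x t i)
        + (lamv / (N : ℝ)) • ∑ j, commRate γ (x t i) (x t j) • (v t j - v t i)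
        + lamw • (w (x t) t - x t i))
      (Set.Ici 0) t

/-- Deviations from the average: `ẑ i = z i - (1/N) ∑ j, z j`. -/
def centered {N M : ℕ} (z : Fin N → EuclideanSpace ℝ (Fin M)) :
    Fin N → EuclideanSpace ℝ (Fin M) :=
  fun i => z i - (1 / (N : ℝ)) • ∑ j, z j

/-- The functional `∑ i, |z i|²`; it is `X` on positions and `V` on favorabilities. -/
def sqDev {N M : ℕ} (z : Fin N → EuclideanSpace ℝ (Fin M)) : ℝ :=
  ∑ i, ‖z i‖ ^ 2

/-- The potential term `S_γ`. -/
def potential {N M : ℕ} (γ : ℝ) (y : Fin N → EuclideanSpace ℝ (Fin M)) : ℝ :=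
  if γ < 2 then
    (1 / (N : ℝ)) * ∑ i, ∑ j, (1 / (1 + ‖y i - y j‖ ^ 2) ^ ((γ - 2) / 2) - 1)
  else if γ = 2 then
    (1 / (N : ℝ)) * ∑ i, ∑ j, Real.log (1 + ‖y i - y j‖ ^ 2)
  else
    (1 / (N : ℝ)) * ∑ i, ∑ j, (1 - 1 / (1 + ‖y i - y j‖ ^ 2) ^ ((γ - 2) / 2))

/-- The normalising constant `β_γ`. -/
def beta (γ : ℝ) : ℝ :=
  if γ < 2 then 2 - γ else if γ = 2 then 2 else γ - 2

/-- The market energy `E₂ = λ_w X + V + λ_x β_γ⁻¹ S_γ` of a configuration `(y, u)`. -/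
def energy {N M : ℕ} (γ lamx lamw : ℝ) (y u : Fin N → EuclideanSpace ℝ (Fin M)) : ℝ :=
  lamw * sqDev y + sqDev u + lamx * (beta γ)⁻¹ * potential γ y

end Herding

end

/-!
The energy is a Lyapunov function, but its dissipation controls velocities only:
subtracting averages removes the market signal `w` and leaves, for `y = x̂` and `u = v̂`,
`E' = -(λ_v / N) ∑ φ_ij |u_i - u_j|²` (`hasDerivWithinAt_energy`). Since `E` is nonincreasing and
bounds `λ_w X`, the configuration stays bounded, so the rates `φ_ij` are bounded below
(`le_commRate`) and `E' ≤ -a V` with `a > 0`.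

To recover dissipation in the positions, `E` is perturbed by a small multiple of the cross term
`H = ∑ ⟨y_i, u_i⟩`. The restoring force `-λ_w y` gives `H' ≤ b V - W / 2` for `W = λ_w X + V`
(`crossTerm_deriv_le`), so for small `ε` the functional `E + ε H` has derivative at most
`-(ε / 2) W`. As `0 ≤ S_γ ≤ β_γ X` (`potential_le`), both `E` and `E + ε H` are comparable with
`W`, and `E + ε H` decays exponentially (`tendsto_zero_of_cross_term`).
-/

namespace Herding

/-! ### Decay from a cross term -/

lemma le_exp_of_deriv_le {F F' : ℝ → ℝ} {δ : ℝ}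
    (hF : ∀ t, 0 ≤ t → HasDerivWithinAt F (F' t) (Set.Ici 0) t)
    (h : ∀ t, 0 ≤ t → F' t ≤ -δ * F t) {t : ℝ} (ht : 0 ≤ t) :
    F t ≤ F 0 * Real.exp (-δ * t) := by
  have hd : ∀ s, 0 ≤ s → HasDerivWithinAt (fun r => F r * Real.exp (δ * r))
      (F' s * Real.exp (δ * s) + F s * (Real.exp (δ * s) * (δ * 1))) (Set.Ici 0) s := fun s hs =>
    (hF s hs).mul (((hasDerivAt_id s).const_mul δ).exp).hasDerivWithinAt
  have hanti : AntitoneOn (fun r => F r * Real.exp (δ * r)) (Set.Ici 0) := by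
    refine antitoneOn_of_hasDerivWithinAt_nonpos (convex_Ici 0)
      (fun s hs => (hd s hs).continuousWithinAt)
      (fun s hs => (hd s (interior_subset hs)).mono interior_subset) fun s hs => ?_
    have h1 := h s (interior_subset hs)
    have h2 := mul_le_mul_of_nonneg_right h1 (Real.exp_pos (δ * s)).le
    linarith
  have h0 := hanti Set.self_mem_Ici ht ht
  simp only [mul_zero, Real.exp_zero, mul_one] at h0
  rw [neg_mul, Real.exp_neg, ← div_eq_mul_inv, le_div_iff₀ (Real.exp_pos _)]
  exact h0

/-- If `E` dissipates only the part `V` of the norm-like quantity `W`, while a cross term `H`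
dissipates `W` up to a multiple of `V`, then `E + ε H` is a strict Lyapunov function for small `ε`
and `E` tends to zero. -/
lemma tendsto_zero_of_cross_term {E E' H H' V W : ℝ → ℝ} {a b A K : ℝ}
    (ha : 0 < a) (hb : 0 < b) (hA : 0 < A) (hK : 0 < K)
    (hE : ∀ t, 0 ≤ t → HasDerivWithinAt E (E' t) (Set.Ici 0) t)
    (hH : ∀ t, 0 ≤ t → HasDerivWithinAt H (H' t) (Set.Ici 0) t)
    (hV : ∀ t, 0 ≤ t → 0 ≤ V t) (hW : ∀ t, 0 ≤ t → 0 ≤ W t)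
    (hWE : ∀ t, 0 ≤ t → W t ≤ E t) (hEW : ∀ t, 0 ≤ t → E t ≤ K * W t)
    (hHW : ∀ t, 0 ≤ t → |H t| ≤ A * W t)
    (hE' : ∀ t, 0 ≤ t → E' t ≤ -a * V t)
    (hH' : ∀ t, 0 ≤ t → H' t ≤ b * V t - W t / 2) :
    Tendsto E atTop (𝓝 0) := by
  obtain ⟨ε, hε, hεA, hεb⟩ : ∃ ε > 0, ε * A ≤ 1 / 2 ∧ ε * b ≤ a := by
    refine ⟨min (1 / 2 / A) (a / b), by positivity, ?_, ?_⟩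
    · rw [← le_div_iff₀ hA]; exact min_le_left _ _
    · rw [← le_div_iff₀ hb]; exact min_le_right _ _
  have hεH : ∀ t, 0 ≤ t → |ε * H t| ≤ W t / 2 := fun t ht => by
    rw [abs_mul, abs_of_pos hε]
    have h1 := mul_le_mul_of_nonneg_left (hHW t ht) hε.le
    have h2 := mul_le_mul_of_nonneg_right hεA (hW t ht)
    linarith
  have hF : ∀ t, 0 ≤ t → HasDerivWithinAt (fun s => E s + ε * H s) (E' t + ε * H' t)
      (Set.Ici 0) t := fun t ht => (hE t ht).add ((hH t ht).const_mul ε)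
  set δ := ε / 2 / (K + 1) with hδ
  have hδ0 : 0 < δ := by positivity
  have hdecay : ∀ t, 0 ≤ t → E' t + ε * H' t ≤ -δ * (E t + ε * H t) := fun t ht => by
    have h1 := mul_le_mul_of_nonneg_left (hH' t ht) hε.le
    have h2 := mul_le_mul_of_nonneg_right hεb (hV t ht)
    have h3 : E t + ε * H t ≤ (K + 1) * W t := by
      linarith [le_of_abs_le (hεH t ht), hEW t ht, hW t ht]
    have h4 := mul_le_mul_of_nonneg_left h3 hδ0.le
    have h5 : δ * ((K + 1) * W t) = ε / 2 * W t := by rw [hδ]; field_simp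
    linarith [hE' t ht]
  have hlim : Tendsto (fun t => 2 * K * ((E 0 + ε * H 0) * Real.exp (-δ * t))) atTop (𝓝 0) := by
    have h1 : Tendsto (fun t : ℝ => -δ * t) atTop atBot :=
      tendsto_id.const_mul_atTop_of_neg (neg_lt_zero.2 hδ0)
    simpa using ((Real.tendsto_exp_atBot.comp h1).const_mul (E 0 + ε * H 0)).const_mul (2 * K)
  refine squeeze_zero' ?_ ?_ hlim
  · filter_upwards [eventually_ge_atTop 0] with t ht using (hW t ht).trans (hWE t ht)
  · filter_upwards [eventually_ge_atTop 0] with t ht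
    have h1 : W t ≤ 2 * (E t + ε * H t) := by
      linarith [neg_le_of_abs_le (hεH t ht), hWE t ht]
    calc E t ≤ K * W t := hEW t ht
      _ ≤ K * (2 * (E t + ε * H t)) := by gcongr
      _ = 2 * K * (E t + ε * H t) := by ring
      _ ≤ _ := by gcongr; exact le_exp_of_deriv_le hF hdecay ht

/-! ### Sums over pairs -/

section Pairs

variable {ι E : Type*} [Fintype ι] [NormedAddCommGroup E] [InnerProductSpace ℝ E]

lemma sum_inner_interaction {k : ι → ι → ℝ} (hk : ∀ i j, k i j = k j i) (a b : ι → E) :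
    ∑ i, inner ℝ (a i) (∑ j, k i j • (b j - b i)) =
      -(1 / 2) * ∑ i, ∑ j, k i j * inner ℝ (a i - a j) (b i - b j) := by
  have h1 : ∀ i, inner ℝ (a i) (∑ j, k i j • (b j - b i)) =
      ∑ j, k i j * inner ℝ (a i) (b j - b i) := fun i => by
    simp only [inner_sum, inner_smul_right]
  have h2 : ∑ i, ∑ j, k i j * inner ℝ (a i) (b j - b i) =
      ∑ i, ∑ j, k i j * inner ℝ (a j) (b i - b j) := by
    rw [Finset.sum_comm]
    simp only [hk]
  have h3 : ∑ i, ∑ j, k i j * inner ℝ (a i - a j) (b i - b j) =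
      -(∑ i, ∑ j, k i j * inner ℝ (a i) (b j - b i)) -
        ∑ i, ∑ j, k i j * inner ℝ (a j) (b i - b j) := by
    simp only [← Finset.sum_neg_distrib, ← Finset.sum_sub_distrib]
    refine Finset.sum_congr rfl fun i _ => Finset.sum_congr rfl fun j _ => ?_
    rw [← neg_sub (b i) (b j), inner_neg_right, inner_sub_left]
    ring
  simp only [h1]
  linarith

lemma sum_interaction_eq_zero {k : ι → ι → ℝ} (hk : ∀ i j, k i j = k j i) (b : ι → E) :
    ∑ i, ∑ j, k i j • (b j - b i) = 0 := by
  have h : ∑ i, ∑ j, k i j • (b j - b i) = -∑ i, ∑ j, k i j • (b j - b i) := by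
    conv_lhs => rw [Finset.sum_comm]
    simp only [← Finset.sum_neg_distrib, ← smul_neg, neg_sub]
    exact Finset.sum_congr rfl fun i _ => Finset.sum_congr rfl fun j _ => by rw [hk]
  have h2 : (2 : ℝ) • ∑ i, ∑ j, k i j • (b j - b i) = 0 := by
    rw [two_smul]
    exact add_eq_zero_iff_eq_neg.2 h
  exact (smul_eq_zero.1 h2).resolve_left two_ne_zero

lemma sum_norm_sub_sq {z : ι → E} (hz : ∑ i, z i = 0) :
    ∑ i, ∑ j, ‖z i - z j‖ ^ 2 = 2 * Fintype.card ι * ∑ i, ‖z i‖ ^ 2 := by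
  have h : ∑ i, ∑ j, inner ℝ (z i) (z j) = 0 := by
    simp only [← inner_sum, hz, inner_zero_right, Finset.sum_const_zero]
  simp only [norm_sub_sq_real, Finset.sum_add_distrib, Finset.sum_sub_distrib, ← Finset.mul_sum,
    h, Finset.sum_const, Finset.card_univ, nsmul_eq_mul]
  ring

end Pairs

/-! ### The pair potential -/

/-- The contribution of one pair at squared distance `s` to `potential`. -/
noncomputable def pairPotential (γ s : ℝ) : ℝ :=
  if γ < 2 then 1 / (1 + s) ^ ((γ - 2) / 2) - 1
  else if γ = 2 then Real.log (1 + s)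
  else 1 - 1 / (1 + s) ^ ((γ - 2) / 2)

lemma potential_eq {N M : ℕ} (γ : ℝ) (y : Fin N → EuclideanSpace ℝ (Fin M)) :
    potential γ y = 1 / (N : ℝ) * ∑ i, ∑ j, pairPotential γ (‖y i - y j‖ ^ 2) := by
  unfold potential pairPotential
  split_ifs <;> rfl

lemma beta_pos (γ : ℝ) : 0 < beta γ := by
  unfold beta
  split_ifs with h1 h2
  · linarith
  · norm_num
  · exact sub_pos.2 (lt_of_le_of_ne (not_lt.1 h1) (Ne.symm h2))

lemma hasDerivAt_pairPotential (γ : ℝ) {s : ℝ} (hs : 0 ≤ s) :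
    HasDerivAt (pairPotential γ) (beta γ / 2 * (1 / (1 + s) ^ (γ / 2))) s := by
  have hpos : 0 < 1 + s := by linarith
  have hadd : HasDerivAt (fun r : ℝ => 1 + r) 1 s := (hasDerivAt_id s).const_add 1
  have hpow : HasDerivAt (fun r : ℝ => 1 / (1 + r) ^ ((γ - 2) / 2))
      ((2 - γ) / 2 * (1 / (1 + s) ^ (γ / 2))) s := by
    have h := (hadd.rpow_const (p := -((γ - 2) / 2)) (Or.inl hpos.ne'))
    have he : (fun r : ℝ => 1 / (1 + r) ^ ((γ - 2) / 2)) =ᶠ[𝓝 s]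
        fun r => (1 + r) ^ (-((γ - 2) / 2)) := by
      filter_upwards [lt_mem_nhds (show -1 < s by linarith)] with r hr
      rw [Real.rpow_neg (by linarith), one_div]
    refine (h.congr_of_eventuallyEq he).congr_deriv ?_
    rw [show -((γ - 2) / 2) - 1 = -(γ / 2) by ring, Real.rpow_neg hpos.le]
    ring
  unfold beta
  by_cases h1 : γ < 2
  · have hf : pairPotential γ = fun r => 1 / (1 + r) ^ ((γ - 2) / 2) - 1 := by
      funext r; simp [pairPotential, h1]
    rw [hf, if_pos h1]
    exact hpow.sub_const 1
  · by_cases h2 : γ = 2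
    · have hf : pairPotential γ = fun r => Real.log (1 + r) := by
        funext r; simp [pairPotential, h2]
      rw [hf, if_neg h1, if_pos h2]
      refine (hadd.log hpos.ne').congr_deriv ?_
      simp [h2]
    · have hf : pairPotential γ = fun r => 1 - 1 / (1 + r) ^ ((γ - 2) / 2) := by
        funext r; simp [pairPotential, h1, h2]
      rw [hf, if_neg h1, if_neg h2]
      refine (hpow.const_sub 1).congr_deriv ?_
      ring

lemma pairPotential_zero (γ : ℝ) : pairPotential γ 0 = 0 := by
  unfold pairPotential
  split_ifs <;> simp

lemma pairPotential_nonneg (γ : ℝ) {s : ℝ} (hs : 0 ≤ s) : 0 ≤ pairPotential γ s := by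
  have hm : MonotoneOn (pairPotential γ) (Set.Ici 0) := by
    refine monotoneOn_of_hasDerivWithinAt_nonneg (convex_Ici 0)
      (fun r hr => (hasDerivAt_pairPotential γ hr).continuousAt.continuousWithinAt)
      (fun r hr => (hasDerivAt_pairPotential γ (interior_subset hr)).hasDerivWithinAt)
      fun r hr => ?_
    have hr0 : 0 ≤ r := interior_subset hr
    have := beta_pos γ
    positivity
  simpa [pairPotential_zero] using hm Set.self_mem_Ici hs hs

lemma pairPotential_le {γ : ℝ} (hγ : 0 ≤ γ) {s : ℝ} (hs : 0 ≤ s) :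
    pairPotential γ s ≤ beta γ / 2 * s := by
  have hd : ∀ r : ℝ, 0 ≤ r → HasDerivAt (fun r => pairPotential γ r - beta γ / 2 * r)
      (beta γ / 2 * (1 / (1 + r) ^ (γ / 2)) - beta γ / 2 * 1) r := fun r hr =>
    (hasDerivAt_pairPotential γ hr).sub ((hasDerivAt_id r).const_mul _)
  have hm : AntitoneOn (fun r => pairPotential γ r - beta γ / 2 * r) (Set.Ici 0) := by
    refine antitoneOn_of_hasDerivWithinAt_nonpos (convex_Ici 0)
      (fun r hr => (hd r hr).continuousAt.continuousWithinAt)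
      (fun r hr => (hd r (interior_subset hr)).hasDerivWithinAt) fun r hr => ?_
    have hr0 : 0 ≤ r := interior_subset hr
    have h1 : 1 / (1 + r) ^ (γ / 2) ≤ 1 :=
      div_le_one_of_le₀ (Real.one_le_rpow (by linarith) (by positivity)) (by positivity)
    have := beta_pos γ
    rw [← mul_sub]
    exact mul_nonpos_of_nonneg_of_nonpos (by positivity) (by linarith)
  have := hm Set.self_mem_Ici hs hs
  simp only [pairPotential_zero, mul_zero, sub_zero] at this
  linarith

/-! ### Configurations -/

variable {N M : ℕ}

lemma commRate_symm (γ : ℝ) (y z : EuclideanSpace ℝ (Fin M)) :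
    commRate γ y z = commRate γ z y := by
  rw [commRate, commRate, norm_sub_rev]

lemma commRate_nonneg (γ : ℝ) (y z : EuclideanSpace ℝ (Fin M)) : 0 ≤ commRate γ y z := by
  unfold commRate
  positivity

lemma commRate_le_one {γ : ℝ} (hγ : 0 ≤ γ) (y z : EuclideanSpace ℝ (Fin M)) :
    commRate γ y z ≤ 1 :=
  div_le_one_of_le₀ (Real.one_le_rpow (by nlinarith [sq_nonneg ‖y - z‖]) (by positivity))
    (by positivity)

lemma le_commRate {γ R : ℝ} (hγ : 0 ≤ γ) {y z : EuclideanSpace ℝ (Fin M)}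
    (h : ‖y - z‖ ^ 2 ≤ R) : 1 / (1 + R) ^ (γ / 2) ≤ commRate γ y z := by
  unfold commRate
  gcongr

lemma sqDev_nonneg (z : Fin N → EuclideanSpace ℝ (Fin M)) : 0 ≤ sqDev z := by
  unfold sqDev
  positivity

lemma norm_sub_sq_le_sqDev (z : Fin N → EuclideanSpace ℝ (Fin M)) (i j : Fin N) :
    ‖z i - z j‖ ^ 2 ≤ 4 * sqDev z := by
  have h : ∀ i, ‖z i‖ ^ 2 ≤ sqDev z := fun i =>
    Finset.single_le_sum (f := fun i => ‖z i‖ ^ 2) (fun _ _ => sq_nonneg _) (Finset.mem_univ i)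
  have h1 := parallelogram_law_with_norm ℝ (z i) (z j)
  nlinarith [h i, h j, mul_self_nonneg ‖z i + z j‖]

lemma centered_sub (z : Fin N → EuclideanSpace ℝ (Fin M)) (i j : Fin N) :
    centered z i - centered z j = z i - z j := by
  simp [centered]

lemma commRate_centered (γ : ℝ) (z : Fin N → EuclideanSpace ℝ (Fin M)) (i j : Fin N) :
    commRate γ (centered z i) (centered z j) = commRate γ (z i) (z j) := by
  rw [commRate, commRate, centered_sub]

lemma sum_centered (hN : N ≠ 0) (z : Fin N → EuclideanSpace ℝ (Fin M)) :
    ∑ i, centered z i = 0 := by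
  have hN' : (N : ℝ) ≠ 0 := Nat.cast_ne_zero.2 hN
  simp only [centered, Finset.sum_sub_distrib, Finset.sum_const, Finset.card_univ,
    Fintype.card_fin]
  rw [← Nat.cast_smul_eq_nsmul ℝ, smul_smul, mul_one_div_cancel hN', one_smul, sub_self]

lemma sum_norm_sub_sq_eq_sqDev {z : Fin N → EuclideanSpace ℝ (Fin M)} (hz : ∑ i, z i = 0) :
    ∑ i, ∑ j, ‖z i - z j‖ ^ 2 = 2 * N * sqDev z := by
  simpa [sqDev] using sum_norm_sub_sq hz

lemma potential_nonneg (γ : ℝ) (y : Fin N → EuclideanSpace ℝ (Fin M)) : 0 ≤ potential γ y := by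
  rw [potential_eq]
  exact mul_nonneg (by positivity) (Finset.sum_nonneg fun i _ => Finset.sum_nonneg fun j _ =>
    pairPotential_nonneg γ (sq_nonneg _))

lemma potential_le (hN : N ≠ 0) {γ : ℝ} (hγ : 0 ≤ γ) {y : Fin N → EuclideanSpace ℝ (Fin M)}
    (hy : ∑ i, y i = 0) : potential γ y ≤ beta γ * sqDev y := by
  have hN' : (N : ℝ) ≠ 0 := Nat.cast_ne_zero.2 hN
  rw [potential_eq]
  calc 1 / (N : ℝ) * ∑ i, ∑ j, pairPotential γ (‖y i - y j‖ ^ 2)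
      ≤ 1 / (N : ℝ) * ∑ i, ∑ j, beta γ / 2 * ‖y i - y j‖ ^ 2 := by
        gcongr with i _ j _
        exact pairPotential_le hγ (sq_nonneg _)
    _ = beta γ * sqDev y := by
        simp only [← Finset.mul_sum]
        rw [sum_norm_sub_sq_eq_sqDev hy]
        field_simp

/-- The cross term `∑ i, ⟨y i, u i⟩`. -/
noncomputable def crossTerm (y u : Fin N → EuclideanSpace ℝ (Fin M)) : ℝ :=
  ∑ i, inner ℝ (y i) (u i)

lemma abs_crossTerm_le (y u : Fin N → EuclideanSpace ℝ (Fin M)) :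
    |crossTerm y u| ≤ (sqDev y + sqDev u) / 2 := by
  unfold crossTerm sqDev
  rw [← Finset.sum_add_distrib, Finset.sum_div]
  refine (Finset.abs_sum_le_sum_abs _ _).trans (Finset.sum_le_sum fun i _ => ?_)
  nlinarith [abs_real_inner_le_norm (y i) (u i), sq_nonneg (‖y i‖ - ‖u i‖)]

/-! ### The centered system -/

/-- The right-hand side of the equation for the centered velocities: the market signal has
cancelled. -/
noncomputable def centeredForce (γ lamx lamv lamw : ℝ)
    (y u : Fin N → EuclideanSpace ℝ (Fin M)) (i : Fin N) : EuclideanSpace ℝ (Fin M) :=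
  (lamx / (N : ℝ)) • ∑ j, commRate γ (y i) (y j) • (y j - y i)
    + (lamv / (N : ℝ)) • ∑ j, commRate γ (y i) (y j) • (u j - u i) - lamw • y i

lemma sum_inner_centeredForce (γ lamx lamv lamw : ℝ) (a y u : Fin N → EuclideanSpace ℝ (Fin M)) :
    ∑ i, inner ℝ (a i) (centeredForce γ lamx lamv lamw y u i) =
      -(lamx / (2 * N)) * ∑ i, ∑ j, commRate γ (y i) (y j) * inner ℝ (a i - a j) (y i - y j)
      - lamv / (2 * N) * ∑ i, ∑ j, commRate γ (y i) (y j) * inner ℝ (a i - a j) (u i - u j)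
      - lamw * ∑ i, inner ℝ (a i) (y i) := by
  have hk : ∀ i j, commRate γ (y i) (y j) = commRate γ (y j) (y i) := fun i j =>
    commRate_symm γ _ _
  have h1 := sum_inner_interaction hk a y
  have h2 := sum_inner_interaction hk a u
  simp only [centeredForce, inner_sub_right (a _) (_ + _), inner_add_right, inner_smul_right,
    Finset.sum_add_distrib, Finset.sum_sub_distrib, ← Finset.mul_sum] at h1 h2 ⊢
  rw [h1, h2]
  ring

/-- The dissipation of the energy along the centered system. -/
noncomputable def dissipation (γ lamv : ℝ) (y u : Fin N → EuclideanSpace ℝ (Fin M)) : ℝ :=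
  lamv / N * ∑ i, ∑ j, commRate γ (y i) (y j) * ‖u i - u j‖ ^ 2

lemma le_dissipation (hN : N ≠ 0) {γ lamv c : ℝ} (hv : 0 ≤ lamv)
    {y u : Fin N → EuclideanSpace ℝ (Fin M)} (hu : ∑ i, u i = 0)
    (hc : ∀ i j, c ≤ commRate γ (y i) (y j)) :
    2 * c * lamv * sqDev u ≤ dissipation γ lamv y u := by
  have hN' : (N : ℝ) ≠ 0 := Nat.cast_ne_zero.2 hN
  calc 2 * c * lamv * sqDev u = lamv / N * ∑ i, ∑ j, c * ‖u i - u j‖ ^ 2 := by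
        simp only [← Finset.mul_sum]
        rw [sum_norm_sub_sq_eq_sqDev hu]
        field_simp
    _ ≤ dissipation γ lamv y u := by
        unfold dissipation
        gcongr with i _ j _
        exact hc i j

/-- The restoring force `-λ_w y` makes the cross term dissipate positions; the alignment force
is absorbed by Young's inequality. -/
lemma crossTerm_deriv_le (hN : N ≠ 0) {γ lamx lamv lamw : ℝ} (hγ : 0 ≤ γ) (hx : 0 ≤ lamx)
    (hv : 0 < lamv) (hw : 0 < lamw) {y u : Fin N → EuclideanSpace ℝ (Fin M)}
    (hy : ∑ i, y i = 0) (hu : ∑ i, u i = 0) :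
    sqDev u + ∑ i, inner ℝ (y i) (centeredForce γ lamx lamv lamw y u i) ≤
      (3 / 2 + lamv ^ 2 / (2 * lamw)) * sqDev u - (lamw * sqDev y + sqDev u) / 2 := by
  have hN' : (N : ℝ) ≠ 0 := Nat.cast_ne_zero.2 hN
  have hpos : 0 ≤ ∑ i, ∑ j, commRate γ (y i) (y j) * inner ℝ (y i - y j) (y i - y j) :=
    Finset.sum_nonneg fun i _ => Finset.sum_nonneg fun j _ =>
      mul_nonneg (commRate_nonneg _ _ _) real_inner_self_nonneg
  have hyoung : -(∑ i, ∑ j, commRate γ (y i) (y j) * inner ℝ (y i - y j) (u i - u j)) ≤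
      ∑ i, ∑ j, (lamw / (2 * lamv) * ‖y i - y j‖ ^ 2 + lamv / (2 * lamw) * ‖u i - u j‖ ^ 2) := by
    simp only [← Finset.sum_neg_distrib]
    refine Finset.sum_le_sum fun i _ => Finset.sum_le_sum fun j _ => ?_
    have h1 := commRate_nonneg γ (y i) (y j)
    have h2 := commRate_le_one hγ (y i) (y j)
    calc -(commRate γ (y i) (y j) * inner ℝ (y i - y j) (u i - u j))
        ≤ |commRate γ (y i) (y j) * inner ℝ (y i - y j) (u i - u j)| := neg_le_abs _
      _ ≤ 1 * (‖y i - y j‖ * ‖u i - u j‖) := by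
          rw [abs_mul, abs_of_nonneg h1]
          exact mul_le_mul h2 (abs_real_inner_le_norm _ _) (abs_nonneg _) zero_le_one
      _ ≤ lamw / (2 * lamv) * ‖y i - y j‖ ^ 2 + lamv / (2 * lamw) * ‖u i - u j‖ ^ 2 := by
          have h : lamw / (2 * lamv) * ‖y i - y j‖ ^ 2 + lamv / (2 * lamw) * ‖u i - u j‖ ^ 2
              - 1 * (‖y i - y j‖ * ‖u i - u j‖) =
              (lamw * ‖y i - y j‖ - lamv * ‖u i - u j‖) ^ 2 / (2 * lamv * lamw) := by
            field_simp
            ring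
          have h0 : 0 ≤ (lamw * ‖y i - y j‖ - lamv * ‖u i - u j‖) ^ 2 / (2 * lamv * lamw) := by
            positivity
          linarith
  simp only [Finset.sum_add_distrib, ← Finset.mul_sum] at hyoung
  rw [sum_norm_sub_sq_eq_sqDev hy, sum_norm_sub_sq_eq_sqDev hu] at hyoung
  have hself : ∑ i, inner ℝ (y i) (y i) = sqDev y := by
    simp only [sqDev, real_inner_self_eq_norm_sq]
  have h1 := mul_le_mul_of_nonneg_left hyoung (show 0 ≤ lamv / (2 * N) by positivity)
  have h2 := mul_nonneg (show 0 ≤ lamx / (2 * N) by positivity) hpos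
  have h3 : lamv / (2 * N) * (lamw / (2 * lamv) * (2 * N * sqDev y) +
      lamv / (2 * lamw) * (2 * N * sqDev u)) =
      lamw / 2 * sqDev y + lamv ^ 2 / (2 * lamw) * sqDev u := by
    field_simp
  rw [sum_inner_centeredForce, hself]
  linarith

/-! ### Derivatives along a solution -/

section Flow

variable {γ lamx lamv lamw : ℝ} {s : Set ℝ} {t : ℝ}
  {y u : ℝ → Fin N → EuclideanSpace ℝ (Fin M)}

lemma hasDerivWithinAt_sqDev {z z' : ℝ → Fin N → EuclideanSpace ℝ (Fin M)}
    (hz : ∀ i, HasDerivWithinAt (fun r => z r i) (z' t i) s t) :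
    HasDerivWithinAt (fun r => sqDev (z r)) (2 * ∑ i, inner ℝ (z t i) (z' t i)) s t := by
  unfold sqDev
  rw [Finset.mul_sum]
  exact HasDerivWithinAt.fun_sum fun i _ => (hz i).norm_sq

lemma hasDerivWithinAt_potential
    (hy : ∀ i, HasDerivWithinAt (fun r => y r i) (u t i) s t) :
    HasDerivWithinAt (fun r => potential γ (y r))
      (beta γ / N * ∑ i, ∑ j, commRate γ (y t i) (y t j) *
        inner ℝ (y t i - y t j) (u t i - u t j)) s t := by
  simp only [potential_eq]
  have h : ∀ i j, HasDerivWithinAt (fun r => pairPotential γ (‖y r i - y r j‖ ^ 2))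
      (beta γ * (commRate γ (y t i) (y t j) * inner ℝ (y t i - y t j) (u t i - u t j))) s t :=
    fun i j => by
      refine ((hasDerivAt_pairPotential γ (sq_nonneg ‖y t i - y t j‖)).comp_hasDerivWithinAt t
        ((hy i).sub (hy j)).norm_sq).congr_deriv ?_
      simp only [commRate, Pi.sub_apply]
      ring
  refine ((HasDerivWithinAt.fun_sum fun i _ =>
    HasDerivWithinAt.fun_sum fun j _ => h i j).const_mul (1 / (N : ℝ))).congr_deriv ?_
  simp only [← Finset.mul_sum]
  ring

/-- Along the centered system, the potential and the quadratic confinement are conservative, so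
only the alignment force changes the energy. -/
lemma hasDerivWithinAt_energy
    (hy : ∀ i, HasDerivWithinAt (fun r => y r i) (u t i) s t)
    (hu : ∀ i, HasDerivWithinAt (fun r => u r i)
      (centeredForce γ lamx lamv lamw (y t) (u t) i) s t) :
    HasDerivWithinAt (fun r => energy γ lamx lamw (y r) (u r))
      (-dissipation γ lamv (y t) (u t)) s t := by
  have hβ := (beta_pos γ).ne'
  refine ((((hasDerivWithinAt_sqDev (z' := u) hy).const_mul lamw).add
    (hasDerivWithinAt_sqDev
      (z' := fun r => centeredForce γ lamx lamv lamw (y r) (u r)) hu)).add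
    ((hasDerivWithinAt_potential (γ := γ) hy).const_mul
      (lamx * (beta γ)⁻¹))).congr_deriv ?_
  have hsymm : ∑ i, inner ℝ (u t i) (y t i) = ∑ i, inner ℝ (y t i) (u t i) :=
    Finset.sum_congr rfl fun i _ => real_inner_comm _ _
  have hsymm' : ∑ i, ∑ j, commRate γ (y t i) (y t j) * inner ℝ (u t i - u t j) (y t i - y t j) =
      ∑ i, ∑ j, commRate γ (y t i) (y t j) * inner ℝ (y t i - y t j) (u t i - u t j) :=
    Finset.sum_congr rfl fun i _ => Finset.sum_congr rfl fun j _ => by rw [real_inner_comm]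
  rw [sum_inner_centeredForce, hsymm, hsymm', dissipation]
  simp only [real_inner_self_eq_norm_sq]
  field_simp
  ring

lemma hasDerivWithinAt_crossTerm
    (hy : ∀ i, HasDerivWithinAt (fun r => y r i) (u t i) s t)
    (hu : ∀ i, HasDerivWithinAt (fun r => u r i)
      (centeredForce γ lamx lamv lamw (y t) (u t) i) s t) :
    HasDerivWithinAt (fun r => crossTerm (y r) (u r))
      (sqDev (u t) + ∑ i, inner ℝ (y t i) (centeredForce γ lamx lamv lamw (y t) (u t) i)) s t := by
  unfold crossTerm
  refine (HasDerivWithinAt.fun_sum fun i _ => (hy i).inner ℝ (hu i)).congr_deriv ?_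
  rw [Finset.sum_add_distrib, add_comm]
  simp only [sqDev, real_inner_self_eq_norm_sq]

end Flow

lemma hasDerivWithinAt_centered {z z' : ℝ → Fin N → EuclideanSpace ℝ (Fin M)} {s : Set ℝ}
    {t : ℝ} (hz : ∀ i, HasDerivWithinAt (fun r => z r i) (z' t i) s t) (i : Fin N) :
    HasDerivWithinAt (fun r => centered (z r) i) (centered (z' t) i) s t :=
  (hz i).sub ((HasDerivWithinAt.fun_sum fun j _ => hz j).const_smul (1 / (N : ℝ)))

/-- Centering the force of the herding model cancels the market signal and the interactions, which
have zero sum. -/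
lemma centered_force (hN : N ≠ 0) (γ lamx lamv lamw : ℝ) (c : EuclideanSpace ℝ (Fin M))
    (x v : Fin N → EuclideanSpace ℝ (Fin M)) (i : Fin N) :
    centered (fun i => (lamx / (N : ℝ)) • ∑ j, commRate γ (x i) (x j) • (x j - x i)
        + (lamv / (N : ℝ)) • ∑ j, commRate γ (x i) (x j) • (v j - v i)
        + lamw • (c - x i)) i =
      centeredForce γ lamx lamv lamw (centered x) (centered v) i := by
  have hN' : (N : ℝ) ≠ 0 := Nat.cast_ne_zero.2 hN
  have hk : ∀ i j, commRate γ (x i) (x j) = commRate γ (x j) (x i) := fun i j =>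
    commRate_symm γ _ _
  simp only [centeredForce, commRate_centered, centered_sub]
  simp only [centered, Finset.sum_add_distrib, ← Finset.smul_sum, sum_interaction_eq_zero hk,
    Finset.sum_sub_distrib, Finset.sum_const, Finset.card_univ, Fintype.card_fin,
    ← Nat.cast_smul_eq_nsmul ℝ]
  match_scalars <;> field_simp
  ring

end Herding

open Herding in
theorem theorem3p6 {N M : ℕ} (γ lamx lamv lamw : ℝ) (hγ : 0 < γ)
    (hx : 0 < lamx) (hv : 0 < lamv) (hw : 0 < lamw)
    (w : (Fin N → EuclideanSpace ℝ (Fin M)) → ℝ → EuclideanSpace ℝ (Fin M))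
    (x v : ℝ → Fin N → EuclideanSpace ℝ (Fin M))
    (hsol : Herding.IsSolution γ lamx lamv lamw w x v) :
    Tendsto
      (fun t : ℝ =>
        Herding.energy γ lamx lamw (Herding.centered (x t)) (Herding.centered (v t)))
      atTop (𝓝 0) := by
  -- For `N = 0` the energy is an empty sum; `1 / N` is then a junk value.
  rcases eq_or_ne N 0 with rfl | hN
  · simp [energy, sqDev, potential]
  set y : ℝ → Fin N → EuclideanSpace ℝ (Fin M) := fun t => centered (x t) with hy
  set u : ℝ → Fin N → EuclideanSpace ℝ (Fin M) := fun t => centered (v t) with hu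
  have hy0 : ∀ t, ∑ i, y t i = 0 := fun t => sum_centered hN _
  have hu0 : ∀ t, ∑ i, u t i = 0 := fun t => sum_centered hN _
  have hyd : ∀ t, 0 ≤ t → ∀ i, HasDerivWithinAt (fun r => y r i) (u t i) (Set.Ici 0) t :=
    fun t ht => hasDerivWithinAt_centered (hsol.deriv_x t ht)
  have hud : ∀ t, 0 ≤ t → ∀ i, HasDerivWithinAt (fun r => u r i)
      (centeredForce γ lamx lamv lamw (y t) (u t) i) (Set.Ici 0) t := fun t ht i => by
    rw [hy, hu, ← centered_force hN γ lamx lamv lamw (w (x t) t)]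
    exact hasDerivWithinAt_centered (z' := fun t i =>
      (lamx / (N : ℝ)) • ∑ j, commRate γ (x t i) (x t j) • (x t j - x t i)
        + (lamv / (N : ℝ)) • ∑ j, commRate γ (x t i) (x t j) • (v t j - v t i)
        + lamw • (w (x t) t - x t i)) (hsol.deriv_v t ht) i
  have hEd := fun t ht => hasDerivWithinAt_energy (hyd t ht) (hud t ht)
  have hHd := fun t ht => hasDerivWithinAt_crossTerm (hyd t ht) (hud t ht)
  have hβ := beta_pos γ
  have hWE : ∀ t, lamw * sqDev (y t) + sqDev (u t) ≤ energy γ lamx lamw (y t) (u t) := fun t => by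
    have := potential_nonneg γ (y t)
    exact le_add_of_nonneg_right (by positivity)
  have hanti : AntitoneOn (fun t => energy γ lamx lamw (y t) (u t)) (Set.Ici 0) := by
    refine antitoneOn_of_hasDerivWithinAt_nonpos (convex_Ici 0)
      (fun t ht => (hEd t ht).continuousWithinAt)
      (fun t ht => (hEd t (interior_subset ht)).mono interior_subset) fun t ht => ?_
    have := le_dissipation hN hv.le (hu0 t) (fun i j => commRate_nonneg γ (y t i) (y t j))
    linarith
  -- `λ_w X ≤ E ≤ E 0` and `|y i - y j|² ≤ 4 X`, so `R` bounds all squared distances.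
  set R := 4 * (energy γ lamx lamw (y 0) (u 0) / lamw) with hR
  have hR0 : 0 ≤ R := by
    have h1 := sqDev_nonneg (y 0)
    have h2 := sqDev_nonneg (u 0)
    have h3 : 0 ≤ energy γ lamx lamw (y 0) (u 0) := le_trans (by positivity) (hWE 0)
    positivity
  have hbdd : ∀ t, 0 ≤ t → ∀ i j, ‖y t i - y t j‖ ^ 2 ≤ R := fun t ht i j => by
    refine (norm_sub_sq_le_sqDev (y t) i j).trans ?_
    rw [hR]
    gcongr
    rw [le_div_iff₀ hw]
    linarith [hWE t, hanti Set.self_mem_Ici ht ht, sqDev_nonneg (u t)]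
  refine tendsto_zero_of_cross_term (V := fun t => sqDev (u t))
    (W := fun t => lamw * sqDev (y t) + sqDev (u t))
    (a := 2 * (1 / (1 + R) ^ (γ / 2)) * lamv) (b := 3 / 2 + lamv ^ 2 / (2 * lamw))
    (A := 1 / lamw + 1) (K := 1 + lamx / lamw) (by positivity) (by positivity) (by positivity)
    (by positivity) hEd hHd (fun t _ => sqDev_nonneg _)
    (fun t _ => add_nonneg (mul_nonneg hw.le (sqDev_nonneg _)) (sqDev_nonneg _))
    (fun t _ => hWE t) (fun t _ => ?_) (fun t _ => ?_) (fun t ht => ?_)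
    fun t _ => crossTerm_deriv_le hN hγ.le hx.le hv hw (hy0 t) (hu0 t)
  · have h1 : lamx * (beta γ)⁻¹ * potential γ (y t) ≤ lamx * sqDev (y t) := by
      calc lamx * (beta γ)⁻¹ * potential γ (y t)
          ≤ lamx * (beta γ)⁻¹ * (beta γ * sqDev (y t)) := by
            gcongr
            exact potential_le hN hγ.le (hy0 t)
        _ = lamx * sqDev (y t) := by field_simp
    have h2 : 0 ≤ lamx / lamw * sqDev (u t) := mul_nonneg (by positivity) (sqDev_nonneg _)
    have h3 : (1 + lamx / lamw) * (lamw * sqDev (y t) + sqDev (u t)) =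
        lamw * sqDev (y t) + sqDev (u t) + lamx * sqDev (y t) + lamx / lamw * sqDev (u t) := by
      field_simp
      ring
    rw [energy, h3]
    linarith
  · have h1 := sqDev_nonneg (y t)
    have h2 := sqDev_nonneg (u t)
    have h3 : (1 / lamw + 1) * (lamw * sqDev (y t) + sqDev (u t)) =
        sqDev (y t) + sqDev (u t) + (lamw * sqDev (y t) + 1 / lamw * sqDev (u t)) := by
      field_simp
      ring
    have h4 : 0 ≤ lamw * sqDev (y t) + 1 / lamw * sqDev (u t) := by positivity
    refine (abs_crossTerm_le _ _).trans ?_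
    rw [h3]
    linarith
  · have := le_dissipation hN hv.le (hu0 t) fun i j => le_commRate hγ.le (hbdd t ht i j)
    linarith
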